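/- Let $N\ge 1$ be an integer. Let $S_0(\mathbb{R})=\{f\in L^2(\mathbb{R}) : \mathbf V_{h_0}f\in L^1(\mathbb{R}^2)\}$ be the Feichtinger algebra, where $\mathbf V_g f(x,\xi)=\int_{\mathbb R} f(t)\overline{g(t-x)}e^{-2\pi i\xi t}\,dt$ and $h_0(t)=e^{-\pi t^2}$, and let $S_0'(\mathbb{R})$ be its dual, with a duality bracket $\langle\varphi,g\rangle$ that is linear in $\varphi$ and conjugate-linear in $g$ (so $\langle\delta_a,g\rangle=\overline{g(a)}$). For $n=0,\dots,N-1$ put $\epsilon_n=\sum_{k\in\mathbb{Z}}\delta_{n/N+k}\in S_0'(\mathbb{R})$, and let $S_N$ be the span of $\epsilon_0,\dots,\epsilon_{N-1}$, with the norm $\bigl\|\sum_n a_n\epsilon_n\bigr\|_{S_N}^2=\sum_{n}|a_n|^2$. For $\lambda>0$ let $h_0^\lambda(t)=e^{-\pi\lambda t^2}$, and for $\varphi\in S_0'(\mathbb{R})$ let $$\mathbf V_{h_0^\lambda}\varphi(x,\xi)=\langle\varphi,\mathbf M_\xi \mathbf T_x h_0^\lambda\rangle,\qquad \mathbf M_\xi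 \mathbf T_x g(t)=e^{2\pi i\xi t}g(t-x).$$ Let $\mathbb{T}_N^2=\mathbb{R}^2/(\mathbb{Z}\times N\mathbb{Z})$. **Theorem.** Let $\lambda>0$ and let $z_1,\dots,z_K\in\mathbb{R}^2$ represent $K$ distinct points of the flat torus $\mathbb{T}_N^2$. The following are equivalent. 1. The points $z_1,\dots,z_K$ give rise to a frame for $S_N$, i.e. there are constants $A,B>0$ such that for every $\varphi\in S_N$ $$A\|\varphi\|_{S_N}^2\le\sum_{k=1}^K|\mathbf V_{h_0^\lambda}\varphi(z_k)|^2\le B\|\varphi\|_{S_N}^2 .$$ 2. Either $K\ge N+1$, or $K=N$ and $\frac1N\sum_{k=1}^N z_k\ne\left(\frac12+\frac nN,\ \frac N2+m\right)$ for all $n,m\in\mathbb{Z}$. (Condition 2 and the sum in 1 do not depend on the choice of the representatives.) -/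

import Mathlib

noncomputable section

open MeasureTheory
open scoped ComplexConjugate

namespace TorusGabor

/-! ### The Feichtinger algebra -/

/-- The (non-normalized) dilated Gaussian `h₀^λ(t) = exp (-π λ t²)`. -/
def gaussian (lam : ℝ) (t : ℝ) : ℂ := (Real.exp (-(Real.pi * lam * t ^ 2)) : ℂ)

/-- The short-time Fourier transform of a function `f` with window `g`:
`V_g f (x, ξ) = ∫ f(t) conj(g(t - x)) e^{-2π i ξ t} dt`. -/
def stft (g f : ℝ → ℂ) (p : ℝ × ℝ) : ℂ :=
  ∫ t : ℝ, f t * conj (g (t - p.1)) * Complex.exp (-(2 * Real.pi * p.2 * t : ℝ) * Complex.I)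

/-- The time-frequency shift `π(x, ξ) g = M_ξ T_x g`, i.e. `t ↦ e^{2π i ξ t} g(t - x)`. -/
def tfShiftFun (p : ℝ × ℝ) (g : ℝ → ℂ) (t : ℝ) : ℂ :=
  Complex.exp ((2 * Real.pi * p.2 * t : ℝ) * Complex.I) * g (t - p.1)

theorem continuous_gaussian (lam : ℝ) : Continuous (gaussian lam) := by
  unfold gaussian; fun_prop

theorem norm_gaussian (lam t : ℝ) :
    ‖gaussian lam t‖ = Real.exp (-(Real.pi * lam * t ^ 2)) := by
  rw [gaussian, Complex.norm_real, Real.norm_eq_abs, abs_of_pos (Real.exp_pos _)]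

theorem memLp_gaussian {lam : ℝ} (hlam : 0 < lam) : MemLp (gaussian lam) 2 volume := by
  rw [memLp_two_iff_integrable_sq_norm (continuous_gaussian lam).aestronglyMeasurable]
  have h := integrable_exp_neg_mul_sq (b := 2 * (Real.pi * lam)) (by positivity)
  refine h.congr (Filter.Eventually.of_forall fun t => ?_)
  simp only [norm_gaussian]
  rw [← Real.exp_nat_mul]
  congr 1
  push_cast
  ring

theorem integrable_mul_window {f : ℝ → ℂ} (hf : MemLp f 2 volume) (x : ℝ) :
    Integrable (fun t => f t * conj (gaussian 1 (t - x))) := by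
  have h1 : MemLp (fun t => gaussian 1 (t - x)) 2 volume :=
    (memLp_gaussian one_pos).comp_measurePreserving (measurePreserving_sub_right volume x)
  have h2 : MemLp (fun t => conj (gaussian 1 (t - x))) 2 volume := h1.star
  exact hf.integrable_mul h2

theorem integrable_stft_integrand {f : ℝ → ℂ} (hf : MemLp f 2 volume) (p : ℝ × ℝ) :
    Integrable (fun t : ℝ => f t * conj (gaussian 1 (t - p.1)) *
      Complex.exp (-(2 * Real.pi * p.2 * t : ℝ) * Complex.I)) := by
  have hm : Continuous fun t : ℝ =>
      Complex.exp (-(2 * Real.pi * p.2 * t : ℝ) * Complex.I) := by fun_prop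
  refine (integrable_mul_window hf p.1).mul_bdd (c := 1) hm.aestronglyMeasurable
    (Filter.Eventually.of_forall fun t => ?_)
  rw [← Complex.ofReal_neg, Complex.norm_exp_ofReal_mul_I]

/-- The underlying linear space of the Feichtinger algebra `S₀(ℝ)`: the `f ∈ L²(ℝ)` with
`V_{h₀} f ∈ L¹(ℝ²)`, where `h₀(t) = exp (-π t²)`. Every such `f` has exactly one continuous
representative, and it is this representative that is taken as the element, so that point
evaluations make sense. -/
def feichtingerSubmodule : Submodule ℂ (ℝ → ℂ) where
  carrier := {f | Continuous f ∧ MemLp f 2 volume ∧ Integrable (stft (gaussian 1) f)}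
  zero_mem' := by
    refine ⟨continuous_const, MemLp.zero, ?_⟩
    have : stft (gaussian 1) 0 = 0 := by
      funext p; simp [stft]
    rw [this]
    exact integrable_zero _ _ _
  add_mem' := by
    rintro f g ⟨hf, hf2, hf1⟩ ⟨hg, hg2, hg1⟩
    refine ⟨hf.add hg, hf2.add hg2, ?_⟩
    have : stft (gaussian 1) (f + g) = stft (gaussian 1) f + stft (gaussian 1) g := by
      funext p
      simp only [stft, Pi.add_apply, add_mul]
      exact integral_add (integrable_stft_integrand hf2 p) (integrable_stft_integrand hg2 p)
    rw [this]
    exact hf1.add hg1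
  smul_mem' := by
    rintro c f ⟨hf, hf2, hf1⟩
    refine ⟨hf.const_smul c, hf2.const_smul c, ?_⟩
    have : stft (gaussian 1) (c • f) = c • stft (gaussian 1) f := by
      funext p
      simp only [stft, Pi.smul_apply, smul_eq_mul, mul_assoc]
      exact integral_const_mul c _
    rw [this]
    exact hf1.smul c

/-- The Feichtinger algebra `S₀(ℝ)`. -/
def Feichtinger : Type := feichtingerSubmodule

namespace Feichtinger

instance : AddCommGroup Feichtinger := inferInstanceAs (AddCommGroup feichtingerSubmodule)
instance : Module ℂ Feichtinger := inferInstanceAs (Module ℂ feichtingerSubmodule)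

/-- The function `ℝ → ℂ` underlying an element of `S₀(ℝ)`. -/
def toFun (f : Feichtinger) : ℝ → ℂ := f.1

instance : CoeFun Feichtinger (fun _ => ℝ → ℂ) := ⟨toFun⟩

theorem add_apply (f g : Feichtinger) (t : ℝ) : (f + g) t = f t + g t := rfl
theorem smul_apply (c : ℂ) (f : Feichtinger) (t : ℝ) : (c • f) t = c * f t := rfl

theorem continuous (f : Feichtinger) : Continuous f := f.2.1
theorem memLp (f : Feichtinger) : MemLp f 2 volume := f.2.2.1
theorem integrable_stft (f : Feichtinger) : Integrable (stft (gaussian 1) f) := f.2.2.2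

theorem stft_add (f g : Feichtinger) (p : ℝ × ℝ) :
    stft (gaussian 1) (f + g : Feichtinger) p
      = stft (gaussian 1) f p + stft (gaussian 1) g p := by
  simp only [stft, add_apply, add_mul]
  exact integral_add (integrable_stft_integrand f.memLp p) (integrable_stft_integrand g.memLp p)

theorem stft_smul (c : ℂ) (f : Feichtinger) (p : ℝ × ℝ) :
    stft (gaussian 1) (c • f : Feichtinger) p = c * stft (gaussian 1) f p := by
  simp only [stft, smul_apply, mul_assoc]
  exact integral_const_mul c _

/-- The norm `‖f‖_{S₀} = ∫_{ℝ²} |V_{h₀} f(x, ξ)| dx dξ`. -/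
def s0Norm (f : Feichtinger) : ℝ := ∫ p : ℝ × ℝ, ‖stft (gaussian 1) f p‖

/-- The function `G(x) = ∫ |V_{h₀} f(x, ξ)| dξ`. -/
def marginal (f : Feichtinger) (x : ℝ) : ℝ := ∫ ξ : ℝ, ‖stft (gaussian 1) f (x, ξ)‖

theorem integrable_marginal (f : Feichtinger) : Integrable f.marginal :=
  Integrable.integral_norm_prod_left (μ := volume) (ν := volume) f.integrable_stft

theorem integral_marginal (f : Feichtinger) : ∫ x, f.marginal x = f.s0Norm := by
  have := integral_prod (μ := (volume : Measure ℝ)) (ν := (volume : Measure ℝ))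
    (fun p : ℝ × ℝ => ‖stft (gaussian 1) f p‖) f.integrable_stft.norm
  exact this.symm

theorem stft_eq_fourier (f : ℝ → ℂ) (x ξ : ℝ) :
    stft (gaussian 1) f (x, ξ)
      = FourierTransform.fourier (fun t => f t * conj (gaussian 1 (t - x))) ξ := by
  rw [Real.fourier_real_eq_integral_exp_smul, stft]
  congr 1
  funext t
  rw [smul_eq_mul, mul_comm]
  congr 2
  push_cast
  ring

theorem ae_norm_mul_le (f : Feichtinger) :
    ∀ᵐ x : ℝ, ∀ t : ℝ, ‖f t‖ * Real.exp (-(Real.pi * (t - x) ^ 2)) ≤ f.marginal x := by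
  have h := Integrable.prod_right_ae (μ := (volume : Measure ℝ)) (ν := (volume : Measure ℝ))
    f.integrable_stft
  filter_upwards [h] with x hx t
  set F : ℝ → ℂ := fun t => f t * conj (gaussian 1 (t - x)) with hF
  have hFc : Continuous F :=
    f.continuous.mul (Complex.continuous_conj.comp
      ((continuous_gaussian 1).comp (continuous_id.sub continuous_const)))
  have hFi : Integrable F := integrable_mul_window f.memLp x
  have hFF : FourierTransform.fourier F = fun ξ => stft (gaussian 1) f (x, ξ) := by
    funext ξ; exact (stft_eq_fourier f x ξ).symm
  have hinv := hFc.fourierInv_fourier_eq hFi (by rw [hFF]; exact hx)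
  have h1 : F t = ∫ ξ : ℝ, Complex.exp ((2 * Real.pi * ξ * t : ℝ) * Complex.I) •
      stft (gaussian 1) f (x, ξ) := by
    rw [← congrFun hinv t, Real.fourierInv_eq', hFF]
    congr 1
    funext ξ
    congr 3
    simp
    ring
  have h2 : ‖F t‖ = ‖f t‖ * Real.exp (-(Real.pi * (t - x) ^ 2)) := by
    rw [hF]
    simp only [norm_mul, RCLike.norm_conj, norm_gaussian, mul_one]
  rw [← h2, h1]
  refine (norm_integral_le_integral_norm _).trans (le_of_eq ?_)
  simp only [norm_smul, Complex.norm_exp_ofReal_mul_I, one_mul, marginal]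

theorem norm_apply_le (f : Feichtinger) (t : ℝ) :
    ‖f t‖ ≤ Real.exp (Real.pi / 4) * ∫ x in (t - 1 / 2)..(t - 1 / 2 + 1), f.marginal x := by
  have key : ∫ _x in (t - 1 / 2)..(t - 1 / 2 + 1), ‖f t‖ * Real.exp (-(Real.pi / 4))
      ≤ ∫ x in (t - 1 / 2)..(t - 1 / 2 + 1), f.marginal x := by
    refine intervalIntegral.integral_mono_ae_restrict (by linarith)
      intervalIntegrable_const f.integrable_marginal.intervalIntegrable ?_
    have h1 := ae_restrict_of_ae (s := Set.Icc (t - 1 / 2) (t - 1 / 2 + 1)) f.ae_norm_mul_le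
    have h2 := ae_restrict_mem (μ := (volume : Measure ℝ))
      (measurableSet_Icc (a := t - 1 / 2) (b := t - 1 / 2 + 1))
    filter_upwards [h1, h2] with x hx hmem
    refine le_trans ?_ (hx t)
    refine mul_le_mul_of_nonneg_left (Real.exp_le_exp.mpr ?_) (norm_nonneg _)
    have : (t - x) ^ 2 ≤ 1 / 4 := by
      nlinarith [hmem.1, hmem.2]
    nlinarith [Real.pi_pos]
  rw [intervalIntegral.integral_const] at key
  have h3 : (t - 1 / 2 + 1 - (t - 1 / 2)) • (‖f t‖ * Real.exp (-(Real.pi / 4)))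
      = ‖f t‖ * Real.exp (-(Real.pi / 4)) := by
    rw [smul_eq_mul]; ring
  rw [h3, Real.exp_neg] at key
  have hpos := Real.exp_pos (Real.pi / 4)
  calc ‖f t‖ = Real.exp (Real.pi / 4) * (‖f t‖ * (Real.exp (Real.pi / 4))⁻¹) := by
        field_simp
    _ ≤ _ := mul_le_mul_of_nonneg_left key hpos.le

theorem hasSum_marginal (f : Feichtinger) (a : ℝ) :
    HasSum (fun k : ℤ => Real.exp (Real.pi / 4) *
      ∫ x in (a + k - 1 / 2)..(a + k - 1 / 2 + 1), f.marginal x)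
      (Real.exp (Real.pi / 4) * f.s0Norm) := by
  have h := (f.integrable_marginal.hasSum_intervalIntegral (a - 1 / 2)).mul_left
    (Real.exp (Real.pi / 4))
  rw [integral_marginal] at h
  have e : ∀ k : ℤ, a - 1 / 2 + (k : ℝ) = a + k - 1 / 2 := fun k => by ring
  simpa only [e] using h

theorem summable_norm_apply (f : Feichtinger) (a : ℝ) :
    Summable (fun k : ℤ => ‖f (a + k)‖) :=
  Summable.of_nonneg_of_le (fun _ => norm_nonneg _) (fun k => f.norm_apply_le (a + k))
    (f.hasSum_marginal a).summable

theorem tsum_norm_apply_le (f : Feichtinger) (a : ℝ) :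
    ∑' k : ℤ, ‖f (a + k)‖ ≤ Real.exp (Real.pi / 4) * f.s0Norm := by
  rw [← (f.hasSum_marginal a).tsum_eq]
  exact (f.summable_norm_apply a).tsum_le_tsum (fun k => f.norm_apply_le (a + k))
    (f.hasSum_marginal a).summable

theorem norm_apply_le_s0Norm (f : Feichtinger) (t : ℝ) :
    ‖f t‖ ≤ Real.exp (Real.pi / 4) * f.s0Norm := by
  refine le_trans ?_ (f.tsum_norm_apply_le t)
  simpa using (f.summable_norm_apply t).le_tsum 0 (fun _ _ => norm_nonneg _)

/-- `‖·‖_{S₀}` as a norm on the additive group `S₀(ℝ)`. -/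
def addGroupNorm : AddGroupNorm Feichtinger where
  toFun := s0Norm
  map_zero' := by
    have : ∀ p, stft (gaussian 1) (0 : Feichtinger) p = 0 := by
      intro p
      have h := stft_smul 0 0 p
      rwa [zero_smul, zero_mul] at h
    simp [s0Norm, this]
  add_le' f g := by
    rw [s0Norm, s0Norm, s0Norm,
      ← integral_add f.integrable_stft.norm g.integrable_stft.norm]
    refine integral_mono (f + g).integrable_stft.norm
      (f.integrable_stft.norm.add g.integrable_stft.norm) fun p => ?_
    simp only [stft_add]
    exact norm_add_le _ _
  neg' f := by
    have h : (-f : Feichtinger) = (-1 : ℂ) • f := (neg_one_smul ℂ f).symm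
    rw [h]
    simp only [s0Norm, stft_smul, norm_mul, norm_neg, norm_one, one_mul]
  eq_zero_of_map_eq_zero' f hf := by
    refine Subtype.ext (funext fun t => ?_)
    have h := f.norm_apply_le_s0Norm t
    rw [hf, mul_zero] at h
    exact norm_le_zero_iff.mp h

instance : NormedAddCommGroup Feichtinger := addGroupNorm.toNormedAddCommGroup

theorem norm_def (f : Feichtinger) : ‖f‖ = ∫ p : ℝ × ℝ, ‖stft (gaussian 1) f p‖ := rfl

instance : NormedSpace ℂ Feichtinger where
  norm_smul_le c f := by
    simp only [norm_def, stft_smul, norm_mul]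
    rw [integral_const_mul]

theorem stft_tfShiftFun (f : ℝ → ℂ) (q p : ℝ × ℝ) :
    stft (gaussian 1) (tfShiftFun q f) p
      = Complex.exp ((2 * Real.pi * (q.2 - p.2) * q.1 : ℝ) * Complex.I)
        * stft (gaussian 1) f (p - q) := by
  rw [stft, stft, ← integral_const_mul,
    ← integral_add_right_eq_self (μ := (volume : Measure ℝ)) _ q.1]
  congr 1
  funext t
  have e : t - (p - q).1 = t + q.1 - p.1 := by
    rw [Prod.fst_sub]; ring
  rw [e]
  simp only [tfShiftFun, Prod.snd_sub, add_sub_cancel_right]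
  have e2 : Complex.exp ((2 * Real.pi * q.2 * (t + q.1) : ℝ) * Complex.I)
        * Complex.exp (-(2 * Real.pi * p.2 * (t + q.1) : ℝ) * Complex.I)
      = Complex.exp ((2 * Real.pi * (q.2 - p.2) * q.1 : ℝ) * Complex.I)
        * Complex.exp (-(2 * Real.pi * (p.2 - q.2) * t : ℝ) * Complex.I) := by
    rw [← Complex.exp_add, ← Complex.exp_add]
    congr 1
    push_cast
    ring
  linear_combination (f t * conj (gaussian 1 (t + q.1 - p.1))) * e2

theorem norm_tfShiftFun (q : ℝ × ℝ) (f : ℝ → ℂ) (t : ℝ) :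
    ‖tfShiftFun q f t‖ = ‖f (t - q.1)‖ := by
  rw [tfShiftFun, norm_mul, Complex.norm_exp_ofReal_mul_I, one_mul]

/-- The time-frequency shift `π(x, ξ) = M_ξ T_x` acting on `S₀(ℝ)`. -/
def tfShift (q : ℝ × ℝ) (f : Feichtinger) : Feichtinger :=
  ⟨tfShiftFun q f, by
    have hc : Continuous (tfShiftFun q f) := by
      have := f.continuous
      unfold tfShiftFun
      fun_prop
    refine ⟨hc, ?_, ?_⟩
    · have h1 : MemLp (fun t => f (t - q.1)) 2 volume :=
        f.memLp.comp_measurePreserving (measurePreserving_sub_right volume q.1)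
      exact h1.of_le hc.aestronglyMeasurable
        (Filter.Eventually.of_forall fun t => (norm_tfShiftFun q f t).le)
    · have h1 : Integrable (fun p : ℝ × ℝ => stft (gaussian 1) f (p - q)) :=
        f.integrable_stft.comp_sub_right q
      have hm : Continuous fun p : ℝ × ℝ =>
          Complex.exp ((2 * Real.pi * (q.2 - p.2) * q.1 : ℝ) * Complex.I) := by fun_prop
      have h2 := h1.bdd_mul (c := 1) hm.aestronglyMeasurable
        (Filter.Eventually.of_forall fun p => by
          rw [Complex.norm_exp_ofReal_mul_I])
      exact h2.congr (Filter.Eventually.of_forall fun p => (stft_tfShiftFun f q p).symm)⟩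

theorem tfShift_apply (q : ℝ × ℝ) (f : Feichtinger) (t : ℝ) :
    tfShift q f t = Complex.exp ((2 * Real.pi * q.2 * t : ℝ) * Complex.I) * f (t - q.1) := rfl

theorem stft_gaussian {lam : ℝ} (hlam : 0 < lam) (p : ℝ × ℝ) :
    stft (gaussian 1) (gaussian lam) p
      = (Real.pi / (Real.pi * (lam + 1)) : ℂ) ^ (1 / 2 : ℂ)
        * Complex.exp (-(Real.pi * p.1 ^ 2)
            + Real.pi * (p.1 - p.2 * Complex.I) ^ 2 / (lam + 1)) := by
  have hb : (-(Real.pi * (lam + 1)) : ℂ).re < 0 := by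
    have : (-(Real.pi * (lam + 1)) : ℂ) = ((-(Real.pi * (lam + 1)) : ℝ) : ℂ) := by
      push_cast; ring
    rw [this, Complex.ofReal_re]
    have := Real.pi_pos
    nlinarith
  have h := integral_cexp_quadratic hb
    (2 * Real.pi * (p.1 - p.2 * Complex.I)) (-(Real.pi * p.1 ^ 2))
  have hpi : (Real.pi : ℂ) ≠ 0 := by exact_mod_cast Real.pi_ne_zero
  have hl : (lam + 1 : ℂ) ≠ 0 := by exact_mod_cast (by linarith : lam + 1 ≠ 0)
  rw [neg_neg] at h
  have e1 : (-(Real.pi * p.1 ^ 2) - (2 * Real.pi * (p.1 - p.2 * Complex.I)) ^ 2 /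
      (4 * -(Real.pi * (lam + 1))) : ℂ)
      = -(Real.pi * p.1 ^ 2) + Real.pi * (p.1 - p.2 * Complex.I) ^ 2 / (lam + 1) := by
    field_simp
    ring
  rw [e1] at h
  rw [← h, stft]
  congr 1
  funext t
  simp only [gaussian, Complex.conj_ofReal]
  rw [Complex.ofReal_exp, Complex.ofReal_exp, ← Complex.exp_add, ← Complex.exp_add]
  congr 1
  push_cast
  ring

/-- The dilated Gaussian `h₀^λ`, `λ > 0`, as an element of `S₀(ℝ)`. -/
def gaussianS0 (lam : ℝ) (hlam : 0 < lam) : Feichtinger :=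
  ⟨gaussian lam, continuous_gaussian lam, memLp_gaussian hlam, by
    have h1 := (integrable_exp_neg_mul_sq (b := Real.pi * lam / (lam + 1)) (by positivity)).mul_prod
      (integrable_exp_neg_mul_sq (b := Real.pi / (lam + 1)) (by positivity))
    have hm : Continuous fun p : ℝ × ℝ => Complex.exp (-(Real.pi * p.1 ^ 2)
            + Real.pi * (p.1 - p.2 * Complex.I) ^ 2 / (lam + 1)) := by fun_prop
    have h2 : Integrable fun p : ℝ × ℝ => Complex.exp (-(Real.pi * p.1 ^ 2)
            + Real.pi * (p.1 - p.2 * Complex.I) ^ 2 / (lam + 1)) := by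
      refine h1.mono' hm.aestronglyMeasurable (Filter.Eventually.of_forall fun p => le_of_eq ?_)
      rw [Complex.norm_exp, ← Real.exp_add]
      congr 1
      have hl : lam + 1 ≠ 0 := by linarith
      have hl' : (lam + 1 : ℂ) ≠ 0 := by exact_mod_cast hl
      have e : (-(Real.pi * p.1 ^ 2) + Real.pi * (p.1 - p.2 * Complex.I) ^ 2 / (lam + 1) : ℂ)
          = ((-(Real.pi * lam / (lam + 1)) * p.1 ^ 2 + -(Real.pi / (lam + 1)) * p.2 ^ 2 : ℝ) : ℂ)
            + ((-(2 * Real.pi * p.1 * p.2 / (lam + 1)) : ℝ) : ℂ) * Complex.I := by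
        push_cast
        field_simp
        ring_nf
        rw [Complex.I_sq]
        ring
      rw [e, Complex.add_re, Complex.ofReal_re, Complex.re_ofReal_mul, Complex.I_re, mul_zero,
        add_zero]
    refine (h2.const_mul _).congr
      (Filter.Eventually.of_forall fun p => (stft_gaussian hlam p).symm)⟩

theorem gaussianS0_apply (lam : ℝ) (hlam : 0 < lam) (t : ℝ) :
    gaussianS0 lam hlam t = (Real.exp (-(Real.pi * lam * t ^ 2)) : ℂ) := rfl

end Feichtinger

/-! ### The dual space, delta trains and the space `S_N` -/

/-- The dual space `S₀'(ℝ)`: the continuous functionals `g ↦ ⟨φ, g⟩` on `S₀(ℝ)`. As usual in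
time-frequency analysis the duality bracket extends the `L²` inner product, so it is linear in the
distribution `φ` and conjugate-linear in the test function `g`. -/
abbrev S0Dual : Type := Feichtinger →L⋆[ℂ] ℂ

/-- The short-time Fourier transform of a distribution `φ ∈ S₀'(ℝ)` with window `g ∈ S₀(ℝ)`:
`V_g φ (x, ξ) = ⟨φ, M_ξ T_x g⟩`. -/
def stftDual (g : Feichtinger) (φ : S0Dual) (p : ℝ × ℝ) : ℂ := φ (g.tfShift p)

/-- The periodic delta train `∑_{k ∈ ℤ} δ_{a + k} ∈ S₀'(ℝ)`, where `⟨δ_x, g⟩ = conj (g x)`. -/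
def deltaComb (a : ℝ) : S0Dual :=
  LinearMap.mkContinuous
    { toFun := fun g : Feichtinger => ∑' k : ℤ, conj (g (a + k))
      map_add' := fun f g => by
        simp only [Feichtinger.add_apply, map_add]
        refine Summable.tsum_add (Summable.of_norm ?_) (Summable.of_norm ?_)
        · simpa only [RCLike.norm_conj] using f.summable_norm_apply a
        · simpa only [RCLike.norm_conj] using g.summable_norm_apply a
      map_smul' := fun c g => by
        simp only [Feichtinger.smul_apply, map_mul, smul_eq_mul]
        exact tsum_mul_left }
    (Real.exp (Real.pi / 4)) (fun g => by
      have hs : Summable fun k : ℤ => ‖conj (g (a + k))‖ := by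
        simpa only [RCLike.norm_conj] using g.summable_norm_apply a
      refine (norm_tsum_le_tsum_norm hs).trans ?_
      simp only [RCLike.norm_conj]
      exact g.tsum_norm_apply_le a)

theorem deltaComb_apply (a : ℝ) (g : Feichtinger) :
    deltaComb a g = ∑' k : ℤ, conj (g (a + k)) := rfl

/-- The delta trains `ε_n = ∑_{k ∈ ℤ} δ_{n/N + k}`, `n = 0, …, N - 1`. -/
def eps (N : ℕ) (n : Fin N) : S0Dual := deltaComb ((n : ℝ) / N)

/-- The space `S_N ⊂ S₀'(ℝ)`, the linear span of `ε_0, …, ε_{N-1}`. -/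
def SN (N : ℕ) : Submodule ℂ S0Dual := Submodule.span ℂ (Set.range (eps N))

theorem deltaComb_tfShift_int (a : ℝ) (g : Feichtinger) (j : ℤ) :
    deltaComb a (g.tfShift (0, (j : ℝ)))
      = Complex.exp (-(2 * Real.pi * j * a : ℝ) * Complex.I) * deltaComb a g := by
  rw [deltaComb_apply, deltaComb_apply, ← tsum_mul_left]
  congr 1
  funext k
  rw [Feichtinger.tfShift_apply, map_mul, ← Complex.exp_conj, sub_zero]
  congr 1
  have e : conj (((2 * Real.pi * j * (a + k) : ℝ) : ℂ) * Complex.I)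
      = -(2 * Real.pi * j * a : ℝ) * Complex.I + ((-(j * k) : ℤ) : ℂ) * (2 * Real.pi * Complex.I) := by
    rw [map_mul, Complex.conj_ofReal, Complex.conj_I]
    push_cast
    ring
  rw [e, Complex.exp_add, Complex.exp_int_mul_two_pi_mul_I, mul_one]

theorem deltaComb_gaussian_ne_zero (a : ℝ) :
    deltaComb a (Feichtinger.gaussianS0 1 one_pos) ≠ 0 := by
  have hs := (Feichtinger.gaussianS0 1 one_pos).summable_norm_apply a
  have e : deltaComb a (Feichtinger.gaussianS0 1 one_pos)
      = ((∑' k : ℤ, ‖Feichtinger.gaussianS0 1 one_pos (a + k)‖ : ℝ) : ℂ) := by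
    rw [deltaComb_apply, Complex.ofReal_tsum]
    congr 1
    funext k
    rw [Feichtinger.gaussianS0_apply, Complex.conj_ofReal, Complex.norm_real, Real.norm_eq_abs,
      abs_of_pos (Real.exp_pos _)]
  rw [e, Complex.ofReal_ne_zero]
  refine (hs.tsum_pos (fun _ => norm_nonneg _) 0 ?_).ne'
  rw [Feichtinger.gaussianS0_apply, Complex.norm_real]
  exact norm_pos_iff.mpr (Real.exp_pos _).ne'

theorem linearIndependent_eps (N : ℕ) : LinearIndependent ℂ (eps N) := by
  rw [Fintype.linearIndependent_iff]
  intro c hc n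
  have hN : (N : ℝ) ≠ 0 := by
    have := n.pos
    positivity
  set w : Fin N → ℂ := fun m => Complex.exp (-(2 * Real.pi * ((m : ℝ) / N) : ℝ) * Complex.I)
    with hw
  have hinj : Function.Injective w := by
    intro m m' h
    rw [hw] at h
    obtain ⟨q, hq⟩ := Complex.exp_eq_exp_iff_exists_int.mp h
    have h2 : ((2 * Real.pi * Complex.I : ℂ)) ≠ 0 := Complex.two_pi_I_ne_zero
    have h3 : ((m : ℕ) : ℂ) = (m' : ℕ) - q * N := by
      have hNC : (N : ℂ) ≠ 0 := by exact_mod_cast hN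
      push_cast at hq
      have h4 : (2 * Real.pi * Complex.I : ℂ) * (((m : ℕ) : ℂ) - ((m' : ℕ) - q * N)) = 0 := by
        field_simp at hq
        linear_combination (-(2 * Real.pi * Complex.I) : ℂ) * hq
      have := (mul_eq_zero.mp h4).resolve_left h2
      linear_combination this
    have h5 : ((m : ℕ) : ℤ) = (m' : ℕ) - q * N := by exact_mod_cast h3
    have hm := m.2
    have hm' := m'.2
    have hq0 : q = 0 := by
      by_contra hne
      rcases lt_or_gt_of_ne hne with h | h
      · have : q ≤ -1 := by omega
        nlinarith
      · have : 1 ≤ q := by omega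
        nlinarith
    rw [hq0] at h5
    exact Fin.ext (by omega)
  have hv := Matrix.eq_zero_of_forall_pow_sum_mul_pow_eq_zero hinj
    (v := fun m => c m * eps N m (Feichtinger.gaussianS0 1 one_pos)) (fun j => by
      have h := congrArg (fun φ : S0Dual =>
        φ ((Feichtinger.gaussianS0 1 one_pos).tfShift (0, (((j : ℕ) : ℤ) : ℝ)))) hc
      simp only [sum_apply, smul_apply, smul_eq_mul,
        zero_apply] at h
      rw [← h]
      refine Finset.sum_congr rfl fun m _ => ?_
      rw [eps, deltaComb_tfShift_int, hw]
      simp only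
      rw [← Complex.exp_nat_mul]
      have : ((j : ℕ) : ℂ) * (-(2 * Real.pi * ((m : ℝ) / N) : ℝ) * Complex.I)
          = -(2 * Real.pi * (((j : ℕ) : ℤ) : ℝ) * ((m : ℝ) / N) : ℝ) * Complex.I := by
        push_cast
        ring
      rw [this]
      ring)
  exact (mul_eq_zero.mp (congrFun hv n)).resolve_right (deltaComb_gaussian_ne_zero _)

/-- `ε_0, …, ε_{N-1}` as a basis of `S_N`. -/
def epsBasis (N : ℕ) : Module.Basis (Fin N) ℂ (SN N) :=
  Module.Basis.span (linearIndependent_eps N)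

theorem coe_epsBasis (N : ℕ) (n : Fin N) : (epsBasis N n : S0Dual) = eps N n :=
  congrArg Subtype.val (Module.Basis.span_apply (linearIndependent_eps N) n)

/-- The inner product `⟨φ, ψ⟩_{S_N} = ∑ a_n conj(b_n)` for `φ = ∑ a_n ε_n`, `ψ = ∑ b_n ε_n`. -/
def snInner {N : ℕ} (φ ψ : SN N) : ℂ :=
  ∑ n : Fin N, (epsBasis N).repr φ n * conj ((epsBasis N).repr ψ n)

/-- The norm of `S_N`, `‖φ‖_{S_N} = ⟨φ, φ⟩_{S_N}^{1/2}`. -/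
def snNorm {N : ℕ} (φ : SN N) : ℝ := Real.sqrt (snInner φ φ).re

/-! ### Flat tori and sampled frames -/

/-- The flat torus `𝕋_N² = ℝ² / (ℤ × Nℤ)`. -/
abbrev FlatTorus (N : ℕ) : Type := AddCircle (1 : ℝ) × AddCircle (N : ℝ)

/-- The quotient map `ℝ² → 𝕋_N²`. -/
def FlatTorus.mk (N : ℕ) (p : ℝ × ℝ) : FlatTorus N :=
  ((p.1 : AddCircle (1 : ℝ)), (p.2 : AddCircle (N : ℝ)))

/-- The points `z_1, …, z_K` give rise to a frame for `S_N` with window `g`: there are constants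
`A, B > 0` with `A ‖φ‖² ≤ ∑_k |V_g φ(z_k)|² ≤ B ‖φ‖²` for all `φ ∈ S_N`. -/
def IsFrameFor (N : ℕ) (g : Feichtinger) {K : ℕ} (z : Fin K → ℝ × ℝ) : Prop :=
  ∃ A B : ℝ, 0 < A ∧ 0 < B ∧ ∀ φ : SN N,
    A * snNorm φ ^ 2 ≤ ∑ k : Fin K, ‖stftDual g φ (z k)‖ ^ 2 ∧
    ∑ k : Fin K, ‖stftDual g φ (z k)‖ ^ 2 ≤ B * snNorm φ ^ 2

end TorusGabor

end

/-!
Put `L = 2πλ / N` and `v = 2π(λ x - i ξ) / N`. For `φ = ∑ a_n ε_n` the transform `V φ (x, ξ)` is, up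
to the factor `exp (-πλ x²)`, the value at `v` of the entire function
`F v = ∑_m a_{m mod N} exp (-πλ m² / N² + m v)`, which satisfies `F (v + 2πi) = F v` and
`F (v + L) = exp (πλ) exp (N v) F v`. Points of the torus `ℝ² / (ℤ × Nℤ)` correspond to points of
`ℂ / (ℤ L + 2πi ℤ)`. Since `S_N` is finite-dimensional, the points form a frame if and only if the
only such `F` that vanishes at all of them is `F = 0` (`isFrameFor_gaussian_iff`).

The zeros of such theta functions are controlled without contour integrals. The product
`thetaProd L v = ∏_{n ≥ 0} (1 - qⁿ e^v) ∏_{n ≥ 1} (1 - qⁿ e^{-v})`, `q = e^{-L}`, is a theta function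
of degree one with simple zeros exactly at the lattice points. A theta function of degree `d` with
`k` zeros that are distinct modulo the lattice is therefore a product of `k` translates of
`thetaProd` and a theta function of degree `d - k` (`IsTheta.exists_eq_prod_mul`), and by Liouville's
theorem a theta function of degree `0` is `c e^{m v}` with `m` an integer
(`IsTheta.eq_const_mul_exp`). This has three consequences.

* More than `d` distinct zeros force `F = 0` (`IsTheta.eq_zero_of_lt_card`), so that `K ≥ N + 1`
  points always form a frame.
* If `F ≠ 0` has `d` distinct zeros, comparing multipliers determines their sum modulo the lattice
  (`IsTheta.exists_multiplier_eq`). For `d = N` this excludes all barycentres other than the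
  exceptional ones (`multiplier_eq_iff`).
* If `K = N` and the barycentre is exceptional, there is an `F ≠ 0` vanishing at `N - 1` of the
  points, as these are `N - 1` linear conditions on `N` coefficients. Dividing by the corresponding
  translates leaves a theta function of degree one. It has a zero, whose position is prescribed by
  the multiplier and is the remaining point (`IsTheta.apply_eq_zero_of_multiplier_eq_prod`).

For `K < N` the points do not form a frame, by counting dimensions.
-/

namespace TorusGabor

open Filter Complex

/-! ### Division of entire functions -/

/-- An entire function can be divided by an entire function all of whose zeros are simple, provided
it vanishes at these zeros. -/
theorem exists_differentiable_eq_mul {f s : ℂ → ℂ} (hf : Differentiable ℂ f)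
    (hs : Differentiable ℂ s) (hsimple : ∀ b, s b = 0 → deriv s b ≠ 0)
    (hfs : ∀ b, s b = 0 → f b = 0) :
    ∃ g : ℂ → ℂ, Differentiable ℂ g ∧ ∀ v, f v = s v * g v := by
  classical
  have hslope : ∀ {u : ℂ → ℂ}, Differentiable ℂ u → ∀ b, Differentiable ℂ (dslope u b) := by
    intro u hu b
    rw [← differentiableOn_univ] at hu ⊢
    exact (Complex.differentiableOn_dslope univ_mem).mpr hu
  refine ⟨fun v => if s v = 0 then deriv f v / deriv s v else f v / s v, fun b => ?_, fun v => ?_⟩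
  · by_cases hb : s b = 0
    · have h0 : dslope s b b ≠ 0 := by rw [dslope_same]; exact hsimple b hb
      have hd : DifferentiableAt ℂ (fun v => dslope f b v / dslope s b v) b :=
        (hslope hf b b).div (hslope hs b b) h0
      refine hd.congr_of_eventuallyEq ?_
      filter_upwards [(hslope hs b).continuous.continuousAt.eventually_ne h0] with v hv
      rcases eq_or_ne v b with rfl | hvb
      · simp [hb, dslope_same]
      · have hsub : v - b ≠ 0 := sub_ne_zero.mpr hvb
        have e1 := sub_smul_dslope s b v
        have e2 := sub_smul_dslope f b v
        rw [hb, sub_zero, smul_eq_mul] at e1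
        rw [hfs b hb, sub_zero, smul_eq_mul] at e2
        have hsv : s v ≠ 0 := by rw [← e1]; exact mul_ne_zero hsub hv
        rw [if_neg hsv, ← e1, ← e2, mul_div_mul_left _ _ hsub]
    · refine ((hf b).div (hs b) hb).congr_of_eventuallyEq ?_
      filter_upwards [hs.continuous.continuousAt.eventually_ne hb] with v hv
      simp [hv]
  · by_cases hv : s v = 0
    · rw [hv, hfs v hv, zero_mul]
    · simp only [if_neg hv]
      field_simp

/-! ### Quasi-periodic entire functions -/

/-- Theta functions of degree `d` and multiplier `C` for the rectangular lattice `ℤ L + 2πi ℤ`: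
entire functions with `F (v + 2πi) = F v` and `F (v + L) = C e^{d v} F v`. The degree may be
negative and `F = 0` is allowed. -/
structure IsTheta (L : ℝ) (d : ℤ) (C : ℂ) (F : ℂ → ℂ) : Prop where
  differentiable : Differentiable ℂ F
  periodic : Function.Periodic F (2 * Real.pi * I)
  add_period : ∀ v, F (v + L) = C * exp (d * v) * F v
  multiplier_ne_zero : C ≠ 0

namespace IsTheta

variable {L : ℝ} {d d' : ℤ} {C C' : ℂ} {F G : ℂ → ℂ}

theorem comp_sub (hF : IsTheta L d C F) (a : ℂ) :
    IsTheta L d (C * exp (-(d * a))) (fun v => F (v - a)) where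
  differentiable := hF.differentiable.comp (differentiable_id.sub_const a)
  periodic v := by
    simp only []
    rw [add_sub_right_comm, hF.periodic]
  add_period v := by
    rw [add_sub_right_comm, hF.add_period, mul_sub, sub_eq_add_neg, exp_add]
    ring
  multiplier_ne_zero := mul_ne_zero hF.multiplier_ne_zero (exp_ne_zero _)

/-- The zero set of a theta function is invariant under the lattice. -/
theorem apply_eq_zero_of_lattice (hF : IsTheta L d C F) {a : ℂ} (ha : F a = 0) (k m : ℤ) :
    F (a + (k * L + m * (2 * Real.pi * I))) = 0 := by
  have hshift : ∀ v, F (v + L) = 0 ↔ F v = 0 := fun v => by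
    simp [hF.add_period v, hF.multiplier_ne_zero, exp_ne_zero]
  have h := hF.periodic.int_mul m (a + k * L)
  rw [add_assoc] at h
  rw [h]
  clear h
  induction k using Int.induction_on with
  | zero => simpa using ha
  | succ k ih =>
    have := (hshift _).mpr ih
    rw [← this]
    congr 1
    push_cast
    ring
  | pred k ih =>
    rw [← hshift, ← ih]
    congr 1
    push_cast
    ring

/-- A quotient of theta functions that is entire is a theta function. -/
theorem of_mul (hF : IsTheta L d C F) (hF0 : ∃ v, F v ≠ 0) (hG : Differentiable ℂ G)
    (h : IsTheta L d' C' (fun v => F v * G v)) : IsTheta L (d' - d) (C' / C) G := by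
  -- `F` is not a zero divisor among entire functions, by the identity theorem.
  have key : ∀ H : ℂ → ℂ, Differentiable ℂ H → (∀ v, F v * H v = 0) → ∀ v, H v = 0 := by
    intro H hH hFH v
    have hFa : AnalyticOnNhd ℂ F Set.univ := fun x _ => hF.differentiable.analyticAt x
    have hHa : AnalyticOnNhd ℂ H Set.univ := fun x _ => hH.analyticAt x
    rcases hFa.eq_zero_or_eq_zero_of_mul_eq_zero hHa (fun z _ => hFH z) isPreconnected_univ with
      h1 | h1
    · obtain ⟨w, hw⟩ := hF0
      exact absurd (h1 w trivial) hw
    · exact h1 v trivial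
  have hC := hF.multiplier_ne_zero
  refine ⟨hG, fun v => ?_, fun v => ?_, div_ne_zero h.multiplier_ne_zero hC⟩
  · refine sub_eq_zero.mp (key (fun v => G (v + 2 * Real.pi * I) - G v) (by fun_prop) (fun w => ?_) v)
    have h1 := h.periodic w
    simp only [hF.periodic w] at h1
    linear_combination h1
  · refine sub_eq_zero.mp (key (fun v => G (v + L) - C' / C * exp ((d' - d : ℤ) * v) * G v)
      (by fun_prop) (fun w => ?_) v)
    have h1 := h.add_period w
    simp only [hF.add_period w] at h1
    have h2 : exp ((d' - d : ℤ) * w) = exp (d' * w) / exp (d * w) := by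
      rw [← exp_sub]; congr 1; push_cast; ring
    have h3 := exp_ne_zero (d * w)
    rw [h2]
    generalize exp (d * w) = E at *
    generalize exp (d' * w) = E' at *
    field_simp
    linear_combination h1

/-- Theta functions of degree `0` are exponentials: twisting by a real exponential makes the
absolute value doubly periodic, so that Liouville's theorem applies. -/
theorem eq_const_mul_exp (hL : 0 < L) (hF : IsTheta L 0 C F) (hF0 : ∃ v, F v ≠ 0) :
    ∃ (c : ℂ) (m : ℤ), c ≠ 0 ∧ C = exp (m * L) ∧ ∀ v, F v = c * exp (m * v) := by
  obtain ⟨w, hw⟩ := hF0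
  set α : ℝ := Real.log ‖C‖ / L with hα
  set h : ℂ → ℂ := fun v => F v * exp (-(α * v)) with hh
  have hdiff : Differentiable ℂ h := hF.differentiable.mul (by fun_prop)
  have hCn : 0 < ‖C‖ := norm_pos_iff.mpr hF.multiplier_ne_zero
  have hn : ∀ v, ‖h v‖ = ‖F v‖ * Real.exp (-(α * v.re)) := fun v => by
    simp [hh, norm_exp]
  have hp1 : Function.Periodic (fun v => ‖h v‖) (L : ℂ) := fun v => by
    simp only [hn, hF.add_period, norm_mul, Int.cast_zero, zero_mul, exp_zero, mul_one,
      add_re, ofReal_re]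
    have : Real.exp (-(α * (v.re + L))) = Real.exp (-(α * v.re)) / ‖C‖ := by
      rw [eq_div_iff hCn.ne']
      rw [← Real.exp_log hCn]
      rw [← Real.exp_add, hα]
      congr 1
      field_simp
      ring
    rw [this]
    field_simp
  have hp2 : Function.Periodic (fun v => ‖h v‖) (2 * Real.pi * I) := fun v => by
    simp [hn, hF.periodic v]
  -- A fundamental rectangle of the lattice bounds `h` everywhere.
  have hcomp : IsCompact (Set.Icc (0 : ℝ) L ×ℂ Set.Icc (0 : ℝ) (2 * Real.pi)) :=
    isCompact_Icc.reProdIm isCompact_Icc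
  obtain ⟨B, hB⟩ := hcomp.exists_bound_of_continuousOn hdiff.continuous.continuousOn
  have hbound : ∀ v, ‖h v‖ ≤ B := fun v => by
    set k := ⌊v.re / L⌋ with hk
    set m := ⌊v.im / (2 * Real.pi)⌋ with hm
    have e1 := hp1.sub_int_mul_eq k (x := v)
    have e2 := hp2.sub_int_mul_eq m (x := v - k * L)
    beta_reduce at e1 e2
    rw [← e1, ← e2]
    have hpi : 0 < 2 * Real.pi := by positivity
    have a1 := Int.floor_le (v.re / L)
    have a2 := Int.lt_floor_add_one (v.re / L)
    have a3 := Int.floor_le (v.im / (2 * Real.pi))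
    have a4 := Int.lt_floor_add_one (v.im / (2 * Real.pi))
    rw [le_div_iff₀ hL] at a1
    rw [div_lt_iff₀ hL] at a2
    rw [le_div_iff₀ hpi] at a3
    rw [div_lt_iff₀ hpi] at a4
    refine hB _ ?_
    rw [mem_reProdIm]
    simp [← hk, ← hm] at *
    constructor <;> constructor <;> linarith
  have hconst : ∀ v, h v = h w := fun v => hdiff.apply_eq_apply_of_bounded
    (isBounded_iff_forall_norm_le.mpr ⟨B, by rintro _ ⟨v, rfl⟩; exact hbound v⟩) v w
  have hc : h w ≠ 0 := mul_ne_zero hw (exp_ne_zero _)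
  have hFe : ∀ v, F v = h w * exp (α * v) := fun v => by
    rw [← hconst v, hh]
    simp only [mul_assoc, ← exp_add]
    simp
  -- The period `2πi` of `F` makes the exponent `α` an integer.
  have h1 := hF.periodic 0
  rw [hFe, hFe, mul_right_inj' hc, mul_add, exp_add, mul_eq_left₀ (exp_ne_zero _)] at h1
  obtain ⟨m, hm⟩ := exp_eq_one_iff.mp h1
  have hαm : (α : ℂ) = m := mul_right_cancel₀ Complex.two_pi_I_ne_zero hm
  refine ⟨h w, m, hc, ?_, fun v => by rw [hFe, hαm]⟩
  have h2 := hF.add_period 0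
  rw [hFe, hFe, hαm] at h2
  simp only [zero_add, mul_zero, exp_zero, mul_one] at h2
  exact mul_left_cancel₀ hc (by rw [h2]; ring)

end IsTheta

/-! ### A theta function of degree one with known zeros -/

/-- The infinite product `∏_{n ≥ 0} (1 - qⁿ z)`. -/
noncomputable def qProd (q z : ℂ) : ℂ := ∏' n : ℕ, (1 + -(q ^ n * z))

section qProd

variable {q : ℂ} (hq : ‖q‖ < 1)
include hq

theorem summable_norm_pow_mul (z : ℂ) : Summable fun n : ℕ => ‖-(q ^ n * z)‖ := by
  simpa using (summable_geometric_of_lt_one (norm_nonneg q) hq).mul_right ‖z‖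

theorem qProd_eq (z : ℂ) : qProd q z = (1 - z) * qProd q (q * z) := by
  have h : Multipliable fun n : ℕ => (1 + -(q ^ (n + 1) * z)) :=
    multipliable_one_add_of_summable ((summable_nat_add_iff 1).mpr (summable_norm_pow_mul hq z))
  have h2 := tprod_eq_zero_mul' (f := fun n : ℕ => 1 + -(q ^ n * z)) h
  rw [qProd, h2, qProd]
  simp only [pow_zero, one_mul, ← sub_eq_add_neg, pow_succ, mul_assoc]

theorem qProd_one : qProd q 1 = 0 := by rw [qProd_eq hq]; simp

theorem exists_of_qProd_eq_zero {z : ℂ} (h : qProd q z = 0) : ∃ n : ℕ, q ^ n * z = 1 := by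
  by_contra! hne
  refine tprod_one_add_ne_zero_of_summable (fun n => ?_) (summable_norm_pow_mul hq z) h
  rw [← sub_eq_add_neg]
  exact sub_ne_zero.mpr (hne n).symm

theorem differentiable_qProd : Differentiable ℂ (qProd q) := by
  intro z
  have hu : Summable fun n : ℕ => ‖q‖ ^ n * (‖z‖ + 1) :=
    (summable_geometric_of_lt_one (norm_nonneg q) hq).mul_right _
  have h := Summable.hasProdLocallyUniformlyOn_nat_one_add (f := fun (n : ℕ) (w : ℂ) => -(q ^ n * w))
    (Metric.isOpen_ball (x := (0 : ℂ)) (ε := ‖z‖ + 1)) hu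
    (.of_forall fun n w hw => by
      rw [mem_ball_zero_iff] at hw
      rw [norm_neg, norm_mul, norm_pow]
      gcongr) (fun n => by fun_prop)
  have h2 := h.differentiableOn (.of_forall fun s => by
    simpa [Finset.prod_fn] using DifferentiableOn.fun_finsetProd (fun _ _ => by fun_prop))
    Metric.isOpen_ball
  exact h2.differentiableAt (Metric.isOpen_ball.mem_nhds (by simp))

end qProd

/-- The theta function `∏_{n ≥ 0} (1 - qⁿ e^v) ∏_{n ≥ 1} (1 - qⁿ e^{-v})`, `q = e^{-L}`. -/
noncomputable def thetaProd (L : ℝ) (v : ℂ) : ℂ :=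
  qProd (exp (-L)) (exp v) * qProd (exp (-L)) (exp (-L - v))

section thetaProd

variable {L : ℝ} (hL : 0 < L)
include hL

theorem norm_exp_neg_lt_one : ‖exp (-(L : ℂ))‖ < 1 := by
  rw [norm_exp]; simpa using hL

theorem isTheta_thetaProd : IsTheta L 1 (-exp L) (thetaProd L) where
  differentiable := by
    have := differentiable_qProd (norm_exp_neg_lt_one hL)
    unfold thetaProd
    fun_prop
  periodic v := by
    simp only [thetaProd, exp_add, exp_sub, exp_two_pi_mul_I, mul_one]
  add_period v := by
    have hq := norm_exp_neg_lt_one hL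
    have e1 : qProd (exp (-L)) (exp (v + L)) = (1 - exp (v + L)) * qProd (exp (-L)) (exp v) := by
      rw [qProd_eq hq, ← exp_add]
      congr 3
      ring
    have e2 : qProd (exp (-L)) (exp (-L - v))
        = (1 - exp (-L - v)) * qProd (exp (-L)) (exp (-L - (v + L))) := by
      rw [qProd_eq hq, ← exp_add]
      congr 3
      ring
    have e3 : exp (v + L) * exp (-L - v) = 1 := by
      rw [← exp_add, ← exp_zero]; congr 1; ring
    have e4 : exp L * exp ((1 : ℤ) * v) = exp (v + L) := by
      rw [← exp_add]; congr 1; push_cast; ring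
    rw [thetaProd, thetaProd, e1, e2, neg_mul, e4]
    linear_combination -(qProd (exp (-L)) (exp v) * qProd (exp (-L)) (exp (-L - (v + L)))) * e3
  multiplier_ne_zero := neg_ne_zero.mpr (exp_ne_zero _)

theorem thetaProd_zero : thetaProd L 0 = 0 := by
  rw [thetaProd, exp_zero, qProd_one (norm_exp_neg_lt_one hL), zero_mul]

theorem thetaProd_eq_zero_iff {v : ℂ} :
    thetaProd L v = 0 ↔ ∃ k m : ℤ, v = k * L + m * (2 * Real.pi * I) := by
  have hq := norm_exp_neg_lt_one hL
  constructor
  · intro h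
    rcases mul_eq_zero.mp h with h | h
    · obtain ⟨n, hn⟩ := exists_of_qProd_eq_zero hq h
      rw [← exp_nat_mul, ← exp_add] at hn
      obtain ⟨m, hm⟩ := exp_eq_one_iff.mp hn
      exact ⟨n, m, by push_cast; linear_combination hm⟩
    · obtain ⟨n, hn⟩ := exists_of_qProd_eq_zero hq h
      rw [← exp_nat_mul, ← exp_add] at hn
      obtain ⟨m, hm⟩ := exp_eq_one_iff.mp hn
      exact ⟨-(n + 1), -m, by push_cast; linear_combination -hm⟩
  · rintro ⟨k, m, rfl⟩
    simpa using (isTheta_thetaProd hL).apply_eq_zero_of_lattice (thetaProd_zero hL) k m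

theorem exists_thetaProd_ne_zero : ∃ v, thetaProd L v ≠ 0 := by
  refine ⟨(L / 2 : ℝ), fun h => ?_⟩
  obtain ⟨k, m, hkm⟩ := (thetaProd_eq_zero_iff hL).mp h
  have h1 := congrArg re hkm
  simp at h1
  have h2 : (k : ℝ) * 2 = 1 := by
    have : ((k : ℝ) * 2 - 1) * L = 0 := by linarith
    rcases mul_eq_zero.mp this with h | h
    · linarith
    · exact absurd h hL.ne'
  have h3 : k * 2 = 1 := by exact_mod_cast h2
  omega

/-- The zeros of `thetaProd` are simple. At `0` this is seen by splitting off the factor `1 - e^v`,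
and quasi-periodicity carries it to the other lattice points. -/
theorem deriv_thetaProd_ne_zero {b : ℂ} (hb : thetaProd L b = 0) : deriv (thetaProd L) b ≠ 0 := by
  have hq := norm_exp_neg_lt_one hL
  have hT := isTheta_thetaProd hL
  have hdq := differentiable_qProd hq
  have hperiod : ∀ m : ℤ, ∀ v, deriv (thetaProd L) (v + m * (2 * Real.pi * I))
      = deriv (thetaProd L) v := fun m v => by
    rw [← deriv_comp_add_const]
    congr 1
    exact funext (hT.periodic.int_mul m)
  have hlat : ∀ k : ℤ, thetaProd L (k * L) = 0 := fun k =>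
    (thetaProd_eq_zero_iff hL).mpr ⟨k, 0, by simp⟩
  have hstep : ∀ k : ℤ, deriv (thetaProd L) ((k + 1 : ℤ) * L)
      = -exp L * exp ((1 : ℤ) * (k * L)) * deriv (thetaProd L) (k * L) := fun k => by
    have e : (((k + 1 : ℤ) : ℂ)) * L = k * L + L := by push_cast; ring
    rw [e, ← deriv_comp_add_const, funext hT.add_period]
    rw [deriv_fun_mul (by fun_prop) (hT.differentiable _), hlat, mul_zero, zero_add]
  have hzero : deriv (thetaProd L) 0 ≠ 0 := by
    set R : ℂ → ℂ := fun v => qProd (exp (-L)) (exp (-L) * exp v)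
      * qProd (exp (-L)) (exp (-L - v)) with hR
    have hRd : Differentiable ℂ R := by fun_prop
    have e : thetaProd L = fun v => (1 - exp v) * R v := by
      funext v
      rw [thetaProd, qProd_eq hq, hR]
      ring
    have hd : HasDerivAt (fun v => (1 - exp v) * R v)
        ((-exp 0) * R 0 + (1 - exp 0) * deriv R 0) 0 :=
      ((Complex.hasDerivAt_exp 0).const_sub 1).mul (hRd 0).hasDerivAt
    have hq0 : qProd (exp (-L)) (exp (-L)) ≠ 0 := fun h => by
      obtain ⟨n, hn⟩ := exists_of_qProd_eq_zero hq h
      have := congrArg norm hn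
      rw [← pow_succ, norm_pow, norm_one] at this
      exact (pow_lt_one₀ (norm_nonneg _) hq (Nat.succ_ne_zero n)).ne this
    rw [e, hd.deriv]
    simpa [hR] using hq0
  obtain ⟨k, m, rfl⟩ := (thetaProd_eq_zero_iff hL).mp hb
  rw [hperiod]
  clear hb
  induction k using Int.induction_on with
  | zero => simpa using hzero
  | succ k ih =>
    rw [hstep]
    exact mul_ne_zero (mul_ne_zero (neg_ne_zero.mpr (exp_ne_zero _)) (exp_ne_zero _)) ih
  | pred k ih =>
    have h := hstep (-k - 1)
    rw [sub_add_cancel] at h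
    rw [h] at ih
    exact right_ne_zero_of_mul ih

/-! ### Dividing out zeros -/

/-- Dividing a theta function by translates of `thetaProd` at finitely many zeros that are distinct
modulo the lattice. -/
theorem IsTheta.exists_eq_prod_mul {ι : Type*} {d : ℤ} {C : ℂ} {F : ℂ → ℂ}
    (hF : IsTheta L d C F) (s : Finset ι) (w : ι → ℂ)
    (hw : ∀ i ∈ s, ∀ j ∈ s, i ≠ j → thetaProd L (w i - w j) ≠ 0) (hzero : ∀ i ∈ s, F (w i) = 0) :
    ∃ G, IsTheta L (d - s.card) (C / ∏ j ∈ s, (-exp (L - w j))) G ∧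
      ∀ v, F v = (∏ j ∈ s, thetaProd L (v - w j)) * G v := by
  classical
  have hT := isTheta_thetaProd hL
  induction s using Finset.induction_on with
  | empty => exact ⟨F, by simpa using hF, by simp⟩
  | insert a s ha ih =>
    obtain ⟨G, hG, hFG⟩ := ih
      (fun i hi j hj => hw i (Finset.mem_insert_of_mem hi) j (Finset.mem_insert_of_mem hj))
      (fun i hi => hzero i (Finset.mem_insert_of_mem hi))
    have hGa : G (w a) = 0 := by
      have h := hzero a (Finset.mem_insert_self a s)
      rw [hFG] at h
      refine (mul_eq_zero.mp h).resolve_left (Finset.prod_ne_zero_iff.mpr fun j hj => ?_)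
      exact hw a (Finset.mem_insert_self a s) j (Finset.mem_insert_of_mem hj)
        (fun h => ha (h ▸ hj))
    have hTa := hT.comp_sub (w a)
    obtain ⟨H, hH, hGH⟩ := exists_differentiable_eq_mul hG.differentiable hTa.differentiable
      (fun b hb => by
        rw [deriv_comp_sub_const]
        exact deriv_thetaProd_ne_zero hL hb)
      (fun b hb => by
        obtain ⟨k, m, hkm⟩ := (thetaProd_eq_zero_iff hL).mp hb
        rw [sub_eq_iff_eq_add'.mp hkm]
        exact hG.apply_eq_zero_of_lattice hGa k m)
    have hne : ∃ v, thetaProd L (v - w a) ≠ 0 := by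
      obtain ⟨v, hv⟩ := exists_thetaProd_ne_zero hL
      exact ⟨v + w a, by simpa using hv⟩
    refine ⟨H, ?_, fun v => ?_⟩
    · have h := hTa.of_mul hne hH ((funext hGH) ▸ hG)
      have e1 : d - (s.card : ℤ) - 1 = d - ((insert a s).card : ℕ) := by
        rw [Finset.card_insert_of_notMem ha]; push_cast; ring
      have e2 : (C / ∏ j ∈ s, (-exp (L - w j))) / (-exp L * exp (-((1 : ℤ) * w a)))
          = C / ∏ j ∈ insert a s, (-exp (L - w j)) := by
        rw [Finset.prod_insert ha]
        have : (-exp L * exp (-((1 : ℤ) * w a))) = -exp (L - w a) := by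
          rw [sub_eq_add_neg, exp_add]; simp
        rw [this, div_div, mul_comm]
      rw [e1] at h
      rwa [← e2]
    · rw [hFG, hGH, Finset.prod_insert ha]
      ring

/-- The multiplier of a theta function of degree `d` determines the sum of its zeros modulo the
lattice, if it has `d` distinct ones. -/
theorem IsTheta.exists_multiplier_eq {ι : Type*} {C : ℂ} {F : ℂ → ℂ} (s : Finset ι) (w : ι → ℂ)
    (hF : IsTheta L s.card C F) (hF0 : ∃ v, F v ≠ 0)
    (hw : ∀ i ∈ s, ∀ j ∈ s, i ≠ j → thetaProd L (w i - w j) ≠ 0) (hzero : ∀ i ∈ s, F (w i) = 0) :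
    ∃ m : ℤ, C = exp (m * L) * ∏ j ∈ s, (-exp (L - w j)) := by
  obtain ⟨G, hG, hFG⟩ := hF.exists_eq_prod_mul hL s w hw hzero
  rw [sub_self] at hG
  have hG0 : ∃ v, G v ≠ 0 := hF0.imp fun v hv h => hv (by rw [hFG, h, mul_zero])
  obtain ⟨-, m, -, hC, -⟩ := hG.eq_const_mul_exp hL hG0
  refine ⟨m, (div_eq_iff (Finset.prod_ne_zero_iff.mpr fun j _ => ?_)).mp hC⟩
  exact neg_ne_zero.mpr (exp_ne_zero _)

/-- A theta function of degree `d` with more than `d` distinct zeros vanishes identically. -/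
theorem IsTheta.eq_zero_of_lt_card {ι : Type*} {d : ℕ} {C : ℂ} {F : ℂ → ℂ}
    (hF : IsTheta L d C F) (s : Finset ι) (hs : d < s.card) (w : ι → ℂ)
    (hw : ∀ i ∈ s, ∀ j ∈ s, i ≠ j → thetaProd L (w i - w j) ≠ 0) (hzero : ∀ i ∈ s, F (w i) = 0)
    (v : ℂ) : F v = 0 := by
  obtain ⟨t, hts, rfl⟩ := Finset.exists_subset_card_eq hs.le
  obtain ⟨b, hb, hbt⟩ := Finset.exists_mem_notMem_of_card_lt_card hs
  obtain ⟨G, hG, hFG⟩ := hF.exists_eq_prod_mul hL t w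
    (fun i hi j hj => hw i (hts hi) j (hts hj)) (fun i hi => hzero i (hts hi))
  rw [sub_self] at hG
  have hGb : G (w b) = 0 := by
    have h := hzero b hb
    rw [hFG] at h
    refine (mul_eq_zero.mp h).resolve_left (Finset.prod_ne_zero_iff.mpr fun j hj => ?_)
    exact hw b hb j (hts hj) (fun h => hbt (h ▸ hj))
  rw [hFG]
  refine mul_eq_zero_of_right _ ?_
  by_contra hv
  obtain ⟨c, m, hc, -, hGe⟩ := hG.eq_const_mul_exp hL ⟨v, hv⟩
  rw [hGe] at hGb
  exact mul_ne_zero hc (exp_ne_zero _) hGb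

/-- A theta function of degree `1` has a zero: otherwise `thetaProd L / F` would be an entire theta
function of degree `0`, hence an exponential, but it vanishes at `0`. -/
theorem IsTheta.exists_zero {C : ℂ} {F : ℂ → ℂ} (hF : IsTheta L 1 C F) : ∃ v, F v = 0 := by
  by_contra! hne
  have hT := isTheta_thetaProd hL
  have e : thetaProd L = fun v => F v * (thetaProd L v / F v) :=
    funext fun v => (mul_div_cancel₀ _ (hne v)).symm
  have hG := hF.of_mul ⟨0, hne 0⟩ (hT.differentiable.div hF.differentiable hne) (e ▸ hT)
  rw [sub_self] at hG
  obtain ⟨v, hv⟩ := exists_thetaProd_ne_zero hL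
  obtain ⟨c, m, hc, -, hGe⟩ := hG.eq_const_mul_exp hL ⟨v, div_ne_zero hv (hne v)⟩
  have h := hGe 0
  simp only [Pi.div_apply, thetaProd_zero hL, zero_div] at h
  exact mul_ne_zero hc (exp_ne_zero _) h.symm

/-- The zero of a theta function of degree `1` is determined by the multiplier. -/
theorem IsTheta.apply_eq_zero_of_multiplier_eq {C : ℂ} {F : ℂ → ℂ} (hF : IsTheta L 1 C F) {a : ℂ}
    {m : ℤ} (hC : C = exp (m * L) * -exp (L - a)) : F a = 0 := by
  by_cases hF0 : ∃ v, F v ≠ 0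
  · obtain ⟨b, hb⟩ := hF.exists_zero hL
    obtain ⟨n, hn⟩ := IsTheta.exists_multiplier_eq hL {b} id (by simpa using hF) hF0
      (by simp) (by simpa using hb)
    rw [hC, Finset.prod_singleton, mul_neg, mul_neg, neg_inj, ← exp_add, ← exp_add,
      exp_eq_exp_iff_exists_int] at hn
    obtain ⟨k, hk⟩ := hn
    have e : a = b + ((m - n : ℤ) * L + (-k : ℤ) * (2 * Real.pi * I)) := by
      push_cast
      simp only [id] at hk
      linear_combination -hk
    rw [e]
    exact hF.apply_eq_zero_of_lattice hb _ _
  · push Not at hF0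
    exact hF0 a

/-- If the multiplier of a theta function of degree `d` is the one prescribed by `d` points, and it
vanishes at all of them but one, then it vanishes at the last one as well. -/
theorem IsTheta.apply_eq_zero_of_multiplier_eq_prod {ι : Type*} [DecidableEq ι] {C : ℂ}
    {F : ℂ → ℂ} (s : Finset ι) (w : ι → ℂ) (hF : IsTheta L s.card C F)
    (hw : ∀ i ∈ s, ∀ j ∈ s, i ≠ j → thetaProd L (w i - w j) ≠ 0) {b : ι} (hb : b ∈ s)
    (hzero : ∀ i ∈ s.erase b, F (w i) = 0) {m : ℤ}
    (hC : C = exp (m * L) * ∏ j ∈ s, (-exp (L - w j))) : F (w b) = 0 := by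
  obtain ⟨G, hG, hFG⟩ := hF.exists_eq_prod_mul hL (s.erase b) w
    (fun i hi j hj => hw i (Finset.mem_of_mem_erase hi) j (Finset.mem_of_mem_erase hj)) hzero
  have hcard : (s.card : ℤ) - ((s.erase b).card : ℕ) = 1 := by
    rw [← Finset.card_erase_add_one hb]; push_cast; ring
  rw [hcard] at hG
  rw [hFG]
  refine mul_eq_zero_of_right _ (hG.apply_eq_zero_of_multiplier_eq hL (m := m) ?_)
  rw [hC, ← Finset.mul_prod_erase s _ hb, ← mul_assoc, mul_div_assoc, div_self, mul_one]
  exact Finset.prod_ne_zero_iff.mpr fun j _ => neg_ne_zero.mpr (exp_ne_zero _)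

end thetaProd

/-! ### The theta functions of the delta trains -/

/-- The point `2π(λ x - i ξ) / N` of the complex plane that corresponds to `p = (x, ξ)`. Under this
map the lattice `ℤ × Nℤ` becomes `ℤ L + 2πi ℤ` with `L = 2πλ / N`. -/
noncomputable def samplePoint (N : ℕ) (lam : ℝ) (p : ℝ × ℝ) : ℂ :=
  2 * Real.pi * (lam * p.1 - p.2 * I) / N

/-- The theta function `v ↦ ∑_{m ≡ n mod N} exp (-πλ m² / N² + m v)`, expressed by the two-variable
Jacobi theta function. -/
noncomputable def thetaBasis (N : ℕ) (lam : ℝ) (n : ℕ) (v : ℂ) : ℂ :=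
  exp (n * v - Real.pi * lam * (n / N) ^ 2)
    * jacobiTheta₂ (N * v / (2 * Real.pi * I) + I * lam * (n / N)) (I * lam)

section thetaBasis

variable {N : ℕ} (hN : N ≠ 0) {lam : ℝ} (hlam : 0 < lam)

/-- The Zak transform of the Gaussian is a Jacobi theta function. -/
theorem deltaComb_tfShift_gaussian (a : ℝ) (p : ℝ × ℝ) :
    deltaComb a ((Feichtinger.gaussianS0 lam hlam).tfShift p)
      = exp (-(2 * Real.pi * p.2 * a) * I - Real.pi * lam * (a - p.1) ^ 2)
        * jacobiTheta₂ (-p.2 + I * lam * (a - p.1)) (I * lam) := by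
  rw [deltaComb_apply, jacobiTheta₂, ← tsum_mul_left]
  refine tsum_congr fun k => ?_
  rw [Feichtinger.tfShift_apply, Feichtinger.gaussianS0_apply, map_mul, ← exp_conj,
    conj_ofReal, map_mul, conj_ofReal, conj_I, ofReal_exp, ← exp_add, jacobiTheta₂_term, ← exp_add,
    exp_eq_exp_iff_exists_int]
  refine ⟨0, ?_⟩
  push_cast
  linear_combination (-(2 * Real.pi * lam * k * (a - p.1)) - Real.pi * lam * k ^ 2) * I_sq

include hN

theorem stftDual_eps (n : Fin N) (p : ℝ × ℝ) :
    stftDual (Feichtinger.gaussianS0 lam hlam) (eps N n) p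
      = exp (-(Real.pi * lam * p.1 ^ 2)) * thetaBasis N lam n (samplePoint N lam p) := by
  have hN' : (N : ℂ) ≠ 0 := by exact_mod_cast hN
  have hpi : (Real.pi : ℂ) ≠ 0 := by exact_mod_cast Real.pi_ne_zero
  rw [stftDual, eps, deltaComb_tfShift_gaussian, thetaBasis, ← mul_assoc, ← exp_add]
  congr 2
  · rw [samplePoint]
    push_cast
    field_simp
    ring
  · rw [samplePoint]
    push_cast
    field_simp
    ring_nf
    simp only [I_sq]
    ring

/-- Translation by an `N`-th part of the period is diagonal, with distinct eigenvalues. -/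
theorem thetaBasis_add (n j : ℕ) (v : ℂ) :
    thetaBasis N lam n (v + j * (2 * Real.pi * I / N))
      = (exp (2 * Real.pi * I / N) ^ n) ^ j * thetaBasis N lam n v := by
  have hN' : (N : ℂ) ≠ 0 := by exact_mod_cast hN
  have hpi : (Real.pi : ℂ) ≠ 0 := by exact_mod_cast Real.pi_ne_zero
  have hper : Function.Periodic (fun z => jacobiTheta₂ z (I * lam)) 1 :=
    fun z => jacobiTheta₂_add_left z _
  have e1 : (N * (v + j * (2 * Real.pi * I / N)) / (2 * Real.pi * I) + I * lam * (n / N) : ℂ)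
      = (N * v / (2 * Real.pi * I) + I * lam * (n / N)) + j * 1 := by
    field_simp
    ring
  have e2 := hper.nat_mul j (N * v / (2 * Real.pi * I) + I * lam * (n / N))
  beta_reduce at e2
  rw [thetaBasis, thetaBasis, e1, e2, ← mul_assoc, ← pow_mul, ← exp_nat_mul, ← exp_add]
  congr 2
  push_cast
  ring

include hlam

theorem isTheta_thetaBasis (n : ℕ) :
    IsTheta (2 * Real.pi * lam / N) N (exp (Real.pi * lam)) (thetaBasis N lam n) where
  differentiable := by
    have h : Differentiable ℂ fun z => jacobiTheta₂ z (I * lam) := fun z =>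
      differentiableAt_jacobiTheta₂_fst z (by simpa using hlam)
    have h2 : Differentiable ℂ fun v : ℂ => N * v / (2 * Real.pi * I) + I * lam * (n / N) := by
      fun_prop
    have h3 := h.comp h2
    have h4 : Differentiable ℂ fun v : ℂ => exp (n * v - Real.pi * lam * (n / N) ^ 2) := by fun_prop
    exact h4.mul h3
  periodic v := by
    have hN' : (N : ℂ) ≠ 0 := by exact_mod_cast hN
    have h := thetaBasis_add (lam := lam) hN n N v
    rw [mul_div_cancel₀ _ hN', ← pow_mul, mul_comm n, pow_mul, ← exp_nat_mul,
      mul_div_cancel₀ _ hN', exp_two_pi_mul_I, one_pow, one_mul] at h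
    exact h
  add_period v := by
    have hN' : (N : ℂ) ≠ 0 := by exact_mod_cast hN
    have hpi : (Real.pi : ℂ) ≠ 0 := by exact_mod_cast Real.pi_ne_zero
    set z : ℂ := N * v / (2 * Real.pi * I) + I * lam * (n / N) with hz
    have e1 : (N * (v + (2 * Real.pi * lam / N : ℝ)) / (2 * Real.pi * I) + I * lam * (n / N) : ℂ)
        = z - I * lam := by
      rw [hz]
      push_cast
      field_simp
      ring_nf
      simp only [I_sq]
      ring
    have e2 := jacobiTheta₂_add_left' (z - I * lam) (I * lam)
    rw [sub_add_cancel] at e2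
    rw [thetaBasis, thetaBasis, e1, ← hz, e2, ← mul_assoc, ← mul_assoc, ← exp_add, ← exp_add,
      ← exp_add]
    congr 2
    rw [hz]
    push_cast
    field_simp
    ring_nf
    simp only [I_sq]
    ring
  multiplier_ne_zero := exp_ne_zero _

theorem isTheta_sum_thetaBasis (a : Fin N → ℂ) :
    IsTheta (2 * Real.pi * lam / N) N (exp (Real.pi * lam))
      (fun v => ∑ n, a n * thetaBasis N lam n v) where
  differentiable := Differentiable.fun_sum fun n _ =>
    (isTheta_thetaBasis hN hlam n).differentiable.const_mul (a n)
  periodic v := Finset.sum_congr rfl fun n _ => by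
    rw [(isTheta_thetaBasis hN hlam n).periodic v]
  add_period v := by
    rw [Finset.mul_sum]
    refine Finset.sum_congr rfl fun n _ => ?_
    rw [(isTheta_thetaBasis hN hlam n).add_period v]
    ring
  multiplier_ne_zero := exp_ne_zero _

omit hN in
theorem thetaBasis_zero_ne_zero (n : ℕ) : thetaBasis N lam n 0 ≠ 0 := by
  refine mul_ne_zero (exp_ne_zero _) ?_
  have e : ∀ k : ℤ, jacobiTheta₂_term k (N * 0 / (2 * Real.pi * I) + I * lam * (n / N)) (I * lam)
      = ((Real.exp (-(2 * Real.pi * k * lam * (n / N)) - Real.pi * k ^ 2 * lam) : ℝ) : ℂ) :=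
    fun k => by
      rw [jacobiTheta₂_term, ofReal_exp]
      congr 1
      push_cast
      ring_nf
      simp only [I_sq]
      ring
  have hs := (summable_jacobiTheta₂_term_iff (N * 0 / (2 * Real.pi * I) + I * lam * (n / N))
    (I * lam)).mpr (by simpa using hlam)
  rw [funext e, summable_ofReal] at hs
  rw [jacobiTheta₂, tsum_congr e, ← ofReal_tsum, ofReal_ne_zero]
  exact (hs.tsum_pos (fun _ => (Real.exp_pos _).le) 0 (Real.exp_pos _)).ne'

/-- The functions `thetaBasis N lam n`, `n < N`, are linearly independent: sampling at `N`-th parts of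
the period gives a Vandermonde system. -/
theorem eq_zero_of_sum_thetaBasis_eq_zero {a : Fin N → ℂ}
    (h : ∀ v, ∑ n, a n * thetaBasis N lam n v = 0) : a = 0 := by
  have hζ := Complex.isPrimitiveRoot_exp N hN
  have hinj : Function.Injective fun n : Fin N => exp (2 * Real.pi * I / N) ^ (n : ℕ) :=
    fun n n' hn => Fin.ext (hζ.pow_inj n.2 n'.2 hn)
  have hv := Matrix.eq_zero_of_forall_pow_sum_mul_pow_eq_zero hinj
    (v := fun n => a n * thetaBasis N lam n 0) (fun j => by
      refine Eq.trans (Finset.sum_congr rfl fun n _ => ?_)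
        (h (0 + (j : ℕ) * (2 * Real.pi * I / N)))
      rw [thetaBasis_add hN]
      ring)
  funext n
  exact (mul_eq_zero.mp (congrFun hv n)).resolve_right (thetaBasis_zero_ne_zero hlam n)

omit hlam hN in
/-- Fewer than `N` points can be prescribed as zeros. -/
theorem exists_sum_thetaBasis_eq_zero {ι : Type*} (s : Finset ι) (hs : s.card < N) (w : ι → ℂ) :
    ∃ a : Fin N → ℂ, a ≠ 0 ∧ ∀ k ∈ s, ∑ n, a n * thetaBasis N lam n (w k) = 0 := by
  let M : Matrix s (Fin N) ℂ := fun k n => thetaBasis N lam n (w k)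
  have hker : LinearMap.ker M.mulVecLin ≠ ⊥ := LinearMap.ker_ne_bot_of_finrank_lt (by simpa using hs)
  obtain ⟨a, ha, ha0⟩ := Submodule.exists_mem_ne_zero_of_ne_bot hker
  refine ⟨a, ha0, fun k hk => ?_⟩
  have h : ∑ n, M ⟨k, hk⟩ n * a n = 0 := congrFun (LinearMap.mem_ker.mp ha) ⟨k, hk⟩
  simpa only [mul_comm] using h

end thetaBasis

/-! ### Frames for `S_N` -/

theorem snNorm_sq {N : ℕ} (φ : SN N) :
    snNorm φ ^ 2 = ‖WithLp.toLp 2 ((epsBasis N).equivFun φ)‖ ^ 2 := by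
  have e : (snInner φ φ).re = ‖WithLp.toLp 2 ((epsBasis N).equivFun φ)‖ ^ 2 := by
    rw [EuclideanSpace.norm_sq_eq, snInner, re_sum]
    refine Finset.sum_congr rfl fun n _ => ?_
    rw [mul_conj, ofReal_re, normSq_eq_norm_sq]
    rfl
  rw [snNorm, e, Real.sq_sqrt (sq_nonneg _)]

theorem stftDual_eq_sum {N : ℕ} (g : Feichtinger) (φ : SN N) (p : ℝ × ℝ) :
    stftDual g φ p = ∑ n, (epsBasis N).equivFun φ n * stftDual g (eps N n) p := by
  have h := congrArg Subtype.val ((epsBasis N).sum_equivFun φ)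
  simp only [Submodule.coe_sum, Submodule.coe_smul, coe_epsBasis] at h
  simp only [stftDual]
  conv_lhs => rw [← h]
  simp only [_root_.sum_apply, _root_.smul_apply, smul_eq_mul]

/-- As `S_N` is finite-dimensional, being a frame means separating the points of `S_N`. -/
theorem isFrameFor_iff {N K : ℕ} (g : Feichtinger) (z : Fin K → ℝ × ℝ) :
    IsFrameFor N g z ↔
      ∀ a : Fin N → ℂ, (∀ k, ∑ n, a n * stftDual g (eps N n) (z k) = 0) → a = 0 := by
  constructor
  · rintro ⟨A, B, hA, -, h⟩ a ha
    obtain ⟨φ, rfl⟩ := (epsBasis N).equivFun.surjective a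
    have h1 := (h φ).1
    simp only [stftDual_eq_sum, ha, norm_zero, ne_eq, OfNat.ofNat_ne_zero, not_false_eq_true,
      zero_pow, Finset.sum_const_zero] at h1
    rw [snNorm_sq] at h1
    have h2 : ‖WithLp.toLp 2 ((epsBasis N).equivFun φ)‖ ^ 2 = 0 :=
      le_antisymm (nonpos_of_mul_nonpos_right h1 hA) (sq_nonneg _)
    simpa using h2
  · intro h
    let M : Matrix (Fin K) (Fin N) ℂ := fun k n => stftDual g (eps N n) (z k)
    let T : EuclideanSpace ℂ (Fin N) →L[ℂ] EuclideanSpace ℂ (Fin K) :=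
      LinearMap.toContinuousLinearMap (Matrix.toEuclideanLin M)
    have hT : ∀ (a : Fin N → ℂ) k,
        T (WithLp.toLp 2 a) k = ∑ n, a n * stftDual g (eps N n) (z k) := fun a k => by
      have e : T (WithLp.toLp 2 a) k = ∑ n, M k n * a n := rfl
      simpa only [mul_comm] using e
    have hker : LinearMap.ker (T : EuclideanSpace ℂ (Fin N) →ₗ[ℂ] EuclideanSpace ℂ (Fin K)) = ⊥ := by
      rw [LinearMap.ker_eq_bot']
      intro a ha
      have h0 := h a.ofLp fun k => by
        rw [← hT]
        exact congrArg (fun b : EuclideanSpace ℂ (Fin K) => b k) ha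
      exact (WithLp.ofLp_eq_zero 2).mp h0
    obtain ⟨c, hc, hanti⟩ := LinearMap.exists_antilipschitzWith _ hker
    have hlow : ∀ a, ‖a‖ ≤ c * ‖T a‖ := fun a => by
      simpa using hanti.le_mul_dist a 0
    have hc' : (0 : ℝ) < c := hc
    refine ⟨1 / (c : ℝ) ^ 2, ‖T‖ ^ 2 + 1, by positivity, by positivity, fun φ => ?_⟩
    have e : ∑ k, ‖stftDual g φ (z k)‖ ^ 2
        = ‖T (WithLp.toLp 2 ((epsBasis N).equivFun φ))‖ ^ 2 := by
      rw [EuclideanSpace.norm_sq_eq]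
      refine Finset.sum_congr rfl fun k _ => ?_
      rw [hT, stftDual_eq_sum]
    rw [e, snNorm_sq]
    generalize WithLp.toLp 2 ((epsBasis N).equivFun φ) = a
    constructor
    · rw [one_div, inv_mul_le_iff₀ (by positivity), ← mul_pow]
      exact pow_le_pow_left₀ (norm_nonneg _) (hlow a) 2
    · have := pow_le_pow_left₀ (norm_nonneg _) (T.le_opNorm a) 2
      nlinarith [sq_nonneg ‖a‖]

/-- The frame property in terms of theta functions: the factor `exp (-πλ x²)` does not vanish and can
be dropped. -/
theorem isFrameFor_gaussian_iff {N K : ℕ} (hN : N ≠ 0) {lam : ℝ} (hlam : 0 < lam)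
    (z : Fin K → ℝ × ℝ) :
    IsFrameFor N (Feichtinger.gaussianS0 lam hlam) z ↔
      ∀ a : Fin N → ℂ, (∀ k, ∑ n, a n * thetaBasis N lam n (samplePoint N lam (z k)) = 0) →
        a = 0 := by
  rw [isFrameFor_iff]
  refine forall_congr' fun a => imp_congr_left (forall_congr' fun k => ?_)
  have e : ∑ n, a n * stftDual (Feichtinger.gaussianS0 lam hlam) (eps N n) (z k)
      = exp (-(Real.pi * lam * (z k).1 ^ 2))
        * ∑ n, a n * thetaBasis N lam n (samplePoint N lam (z k)) := by
    rw [Finset.mul_sum]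
    refine Finset.sum_congr rfl fun n _ => ?_
    rw [stftDual_eps hN hlam]
    ring
  rw [e, mul_eq_zero, or_iff_right (exp_ne_zero _)]

/-! ### The torus and the sum condition -/

section torus

variable {N : ℕ} (hN : N ≠ 0) {lam : ℝ} (hlam : 0 < lam)
include hN hlam

/-- Distinct points of the torus give points that are distinct modulo the lattice. -/
theorem thetaProd_samplePoint_sub_ne_zero {p q : ℝ × ℝ} (h : FlatTorus.mk N p ≠ FlatTorus.mk N q) :
    thetaProd (2 * Real.pi * lam / N) (samplePoint N lam p - samplePoint N lam q) ≠ 0 := by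
  have hN' : (0 : ℝ) < N := by exact_mod_cast Nat.pos_of_ne_zero hN
  have hL : 0 < 2 * Real.pi * lam / N := by positivity
  intro h0
  obtain ⟨k, m, hkm⟩ := (thetaProd_eq_zero_iff hL).mp h0
  have e : samplePoint N lam p - samplePoint N lam q
      = ((2 * Real.pi * lam / N * (p.1 - q.1) : ℝ) : ℂ)
        + ((-(2 * Real.pi * (p.2 - q.2) / N) : ℝ) : ℂ) * I := by
    simp only [samplePoint]; push_cast; ring
  have e' : (k * (2 * Real.pi * lam / N : ℝ) + m * (2 * Real.pi * I) : ℂ)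
      = ((k * (2 * Real.pi * lam / N) : ℝ) : ℂ) + ((m * (2 * Real.pi) : ℝ) : ℂ) * I := by
    push_cast; ring
  rw [e, e'] at hkm
  have h1 := congrArg re hkm
  have h2 := congrArg im hkm
  simp only [add_re, ofReal_re, re_ofReal_mul, I_re, mul_zero, add_zero, add_im, ofReal_im,
    im_ofReal_mul, I_im, mul_one, zero_add] at h1 h2
  have h1' : (p.1 - q.1) = k := mul_left_cancel₀ hL.ne' (by rw [h1]; ring)
  have h2' : (p.2 - q.2) = -m * N := by
    have hpi := Real.pi_ne_zero
    field_simp at h2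
    linarith
  refine h (Prod.ext ?_ ?_)
  · change (p.1 : AddCircle (1 : ℝ)) = q.1
    rw [← sub_eq_zero, ← AddCircle.coe_sub, AddCircle.coe_eq_zero_iff]
    exact ⟨k, by simp [h1']⟩
  · change (p.2 : AddCircle (N : ℝ)) = q.2
    rw [← sub_eq_zero, ← AddCircle.coe_sub, AddCircle.coe_eq_zero_iff]
    exact ⟨-m, by simp [h2']⟩

/-- The multiplier of the theta functions is the one prescribed by the sample points exactly if the
barycentre of these points is one of the exceptional points. -/
theorem multiplier_eq_iff (z : Fin N → ℝ × ℝ) :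
    (∃ m : ℤ, exp (Real.pi * lam) = exp (m * (2 * Real.pi * lam / N : ℝ)) *
        ∏ k, (-exp ((2 * Real.pi * lam / N : ℝ) - samplePoint N lam (z k)))) ↔
      ∃ n m : ℤ, (1 / (N : ℝ)) • ∑ k, z k = (1 / 2 + (n : ℝ) / N, (N : ℝ) / 2 + m) := by
  have hN' : (N : ℝ) ≠ 0 := by exact_mod_cast hN
  have hNC : (N : ℂ) ≠ 0 := by exact_mod_cast hN
  have hpi := Real.pi_ne_zero
  set X : ℝ := ∑ k, (z k).1 with hX
  set Y : ℝ := ∑ k, (z k).2 with hY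
  have hsum : ∑ k, z k = (X, Y) := Prod.ext (by simp [hX, Prod.fst_sum]) (by simp [hY, Prod.snd_sum])
  have hprod : ∏ k, (-exp ((2 * Real.pi * lam / N : ℝ) - samplePoint N lam (z k)))
      = exp (2 * Real.pi * lam - 2 * Real.pi * (lam * X - Y * I) / N + N * (Real.pi * I)) := by
    have e : ∀ k, -exp ((2 * Real.pi * lam / N : ℝ) - samplePoint N lam (z k))
        = exp ((2 * Real.pi * lam / N : ℝ) - samplePoint N lam (z k) + Real.pi * I) := fun k => by
      rw [exp_add, exp_pi_mul_I]; ring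
    rw [Finset.prod_congr rfl fun k _ => e k, ← exp_sum]
    congr 1
    simp only [samplePoint, Finset.sum_add_distrib, Finset.sum_sub_distrib, Finset.sum_const,
      Finset.card_univ, Fintype.card_fin, ← Finset.sum_div, ← Finset.mul_sum, ← Finset.sum_mul,
      nsmul_eq_mul, hX, hY]
    push_cast
    field_simp
  rw [hsum, hprod]
  -- The real part of the equation of exponents concerns the first coordinates of the points, the
  -- imaginary part the second ones.
  have key : ∀ m l : ℤ,
      (Real.pi * lam : ℂ) = m * (2 * Real.pi * lam / N : ℝ) +
        (2 * Real.pi * lam - 2 * Real.pi * (lam * X - Y * I) / N + N * (Real.pi * I)) +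
        l * (2 * Real.pi * I) ↔
      ((1 / (N : ℝ)) • (X, Y) : ℝ × ℝ) = (1 / 2 + (m : ℝ) / N, (N : ℝ) / 2 + (-l - N : ℤ)) := by
    intro m l
    have e : (m * (2 * Real.pi * lam / N : ℝ) +
        (2 * Real.pi * lam - 2 * Real.pi * (lam * X - Y * I) / N + N * (Real.pi * I)) +
        l * (2 * Real.pi * I) : ℂ)
        = ((m * (2 * Real.pi * lam / N) + 2 * Real.pi * lam - 2 * Real.pi * lam * X / N : ℝ) : ℂ)
          + ((2 * Real.pi * Y / N + N * Real.pi + l * (2 * Real.pi) : ℝ) : ℂ) * I := by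
      push_cast; ring
    have e' : (Real.pi * lam : ℂ) = ((Real.pi * lam : ℝ) : ℂ) + ((0 : ℝ) : ℂ) * I := by
      push_cast; ring
    rw [e, e', Complex.ext_iff, Prod.ext_iff]
    simp only [add_re, ofReal_re, re_ofReal_mul, I_re, mul_zero, add_zero, add_im, ofReal_im,
      im_ofReal_mul, I_im, mul_one, zero_add, Prod.smul_mk, smul_eq_mul]
    have hlam' := hlam.ne'
    push_cast
    refine and_congr ?_ ?_
    · field_simp
      constructor <;> intro h <;> linarith
    · have e2 : 2 * Real.pi * Y / N + N * Real.pi + l * (2 * Real.pi)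
          = 2 * Real.pi * (1 / N * Y - (N / 2 + (-l - N))) := by
        field_simp
        ring
      rw [e2, eq_comm, mul_eq_zero, or_iff_right (by positivity), sub_eq_zero]
  constructor
  · rintro ⟨m, hm⟩
    rw [← exp_add, exp_eq_exp_iff_exists_int] at hm
    obtain ⟨l, hl⟩ := hm
    exact ⟨m, _, (key m l).mp hl⟩
  · rintro ⟨n, m, h⟩
    refine ⟨n, ?_⟩
    rw [← exp_add, exp_eq_exp_iff_exists_int]
    refine ⟨-m - N, (key n (-m - N)).mpr ?_⟩
    rw [h]
    push_cast
    ring_nf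

end torus

end TorusGabor

theorem mainTheorem2 (N : ℕ) (hN : 1 ≤ N) (lam : ℝ) (hlam : 0 < lam) (K : ℕ)
    (z : Fin K → ℝ × ℝ)
    (hz : Function.Injective fun k => TorusGabor.FlatTorus.mk N (z k)) :
    TorusGabor.IsFrameFor N (TorusGabor.Feichtinger.gaussianS0 lam hlam) z ↔
      (N + 1 ≤ K ∨
        (K = N ∧ ∀ n m : ℤ,
          (1 / (N : ℝ)) • ∑ k : Fin K, z k ≠ (1 / 2 + (n : ℝ) / N, (N : ℝ) / 2 + m))) := by
  have hN0 : N ≠ 0 := by omega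
  have hNpos : (0 : ℝ) < N := by exact_mod_cast hN
  have hL : 0 < 2 * Real.pi * lam / N := by positivity
  have hw : ∀ i ∈ Finset.univ, ∀ j ∈ Finset.univ, i ≠ j →
      TorusGabor.thetaProd (2 * Real.pi * lam / N)
        (TorusGabor.samplePoint N lam (z i) - TorusGabor.samplePoint N lam (z j)) ≠ 0 :=
    fun i _ j _ hij => TorusGabor.thetaProd_samplePoint_sub_ne_zero hN0 hlam fun h => hij (hz h)
  rw [TorusGabor.isFrameFor_gaussian_iff hN0 hlam]
  rcases lt_trichotomy K N with hK | rfl | hK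
  · refine iff_of_false (fun h => ?_) (by omega)
    obtain ⟨a, ha0, ha⟩ := TorusGabor.exists_sum_thetaBasis_eq_zero (lam := lam)
      (Finset.univ : Finset (Fin K)) (by simpa using hK)
      (fun k => TorusGabor.samplePoint N lam (z k))
    exact ha0 (h a fun k => ha k (Finset.mem_univ k))
  · have hM := TorusGabor.multiplier_eq_iff hN0 hlam z
    have hR : (K + 1 ≤ K ∨ (K = K ∧ ∀ n m : ℤ,
        (1 / (K : ℝ)) • ∑ k : Fin K, z k ≠ (1 / 2 + (n : ℝ) / K, (K : ℝ) / 2 + m))) ↔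
        ¬ ∃ n m : ℤ, (1 / (K : ℝ)) • ∑ k, z k = (1 / 2 + (n : ℝ) / K, (K : ℝ) / 2 + m) := by
      simp
    rw [hR, ← hM]
    constructor
    · rintro h ⟨m, hm⟩
      have b : Fin K := ⟨0, hN⟩
      obtain ⟨a, ha0, ha⟩ := TorusGabor.exists_sum_thetaBasis_eq_zero (N := K) (lam := lam)
        ((Finset.univ : Finset (Fin K)).erase b)
        (by rw [Finset.card_erase_of_mem (Finset.mem_univ b), Finset.card_univ, Fintype.card_fin]
            omega)
        (fun k => TorusGabor.samplePoint K lam (z k))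
      have hF := TorusGabor.isTheta_sum_thetaBasis hN0 hlam a
      have hb := TorusGabor.IsTheta.apply_eq_zero_of_multiplier_eq_prod hL Finset.univ _
        (by simpa using hF) hw (Finset.mem_univ b) ha hm
      refine ha0 (h a fun k => ?_)
      by_cases hk : k = b
      · rw [hk]; exact hb
      · exact ha k (Finset.mem_erase.mpr ⟨hk, Finset.mem_univ k⟩)
    · intro hne a ha
      by_contra ha0
      have hF := TorusGabor.isTheta_sum_thetaBasis hN0 hlam a
      have hF0 : ∃ v, ∑ n, a n * TorusGabor.thetaBasis K lam n v ≠ 0 := by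
        by_contra! h0
        exact ha0 (TorusGabor.eq_zero_of_sum_thetaBasis_eq_zero hN0 hlam h0)
      exact hne (TorusGabor.IsTheta.exists_multiplier_eq hL Finset.univ _ (by simpa using hF) hF0 hw
        fun k _ => ha k)
  · refine iff_of_true (fun a ha => ?_) (Or.inl hK)
    have hF := TorusGabor.isTheta_sum_thetaBasis hN0 hlam a
    refine TorusGabor.eq_zero_of_sum_thetaBasis_eq_zero hN0 hlam fun v => ?_
    exact TorusGabor.IsTheta.eq_zero_of_lt_card hL hF Finset.univ (by simpa using hK) _ hw
      (fun k _ => ha k) v
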